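/- Let the braid group $B_3=\langle\beta_1,\beta_2\mid\beta_1\beta_2\beta_1=\beta_2\beta_1\beta_2\rangle$ act on triples $(x_1,x_2,x_3)\in\mathbb C^3$ by $$\beta_1(x_1,x_2,x_3)=(-x_1,\,x_3-x_1x_2,\,x_2),\qquad \beta_2(x_1,x_2,x_3)=(x_3,\,-x_2,\,x_1-x_2x_3).$$ A triple is called *admissible* if at most one of its coordinates is zero; two triples are called *equivalent* if they are equal up to the change of two signs of the coordinates. An admissible triple $(x_1,x_2,x_3)$ is called *good* if for every $\beta\in B_3$ there are rational numbers $0\le r_1^\beta,r_2^\beta,r_3^\beta\le 1$ with $\beta(x_1,x_2,x_3)=(-2\cos\pi r_1^\beta,-2\cos\pi r_2^\beta,-2\cos\pi r_3^\beta)$. Write $[a,b,c]=(-2\cos\pi a,-2\cos\pi b,-2\cos\pi c)$. **Theorem 1.6.** Every good triple with $x_1^2+x_2^2+x_3^2-x_1x_2x_3\ne 4$ belongs to the $B_3$-orbit of one of the five triples $$(1)\ \left[\tfrac12,\tfrac13,\tfrac13\right],\quad (2)\ \left[\tfrac12,\tfrac13,\tfrac14\right],\quad (3)\ \left[\tfrac12,\tfrac13,\tfrac15\right],\quad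 (4)\ \left[\tfrac12,\tfrac13,\tfrac25\right],\quad (5)\ \left[\tfrac12,\tfrac15,\tfrac25\right].$$ These five orbits are finite and pairwise distinct; moreover, no triple of one of them is equivalent to a triple of another. Each orbit contains all the permutations of the corresponding triple (1)–(5), and also the following triples, respectively, together with all their permutations: - orbit of (1): $\left(2\cos\frac\pi3,2\cos\frac\pi3,2\cos\frac\pi3\right)$; - orbit of (2): $\left[\frac23,\frac14,\frac14\right]$; - orbit of (3): $\left[\frac23,\frac15,\frac15\right]$ and $\left[\frac45,\frac45,\frac45\right]$; - orbit of (4): $\left[\frac23,\frac25,\frac25\right]$ and $\left[\frac25,\frac25,\frac25\right]$; - orbit of (5): $\left[\frac35,\frac13,\frac15\right]$, $\left[\frac25,\frac13,\frac13\right]$ and $\left[\frac23,\frac13,\frac15\right]$. -/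

import Mathlib

/-- The defining relation `β₁ β₂ β₁ = β₂ β₁ β₂` of the braid group on three strings, with
`β₁ = FreeGroup.of 0` and `β₂ = FreeGroup.of 1`. -/
def braidRels : Set (FreeGroup (Fin 2)) :=
  {FreeGroup.of 0 * FreeGroup.of 1 * FreeGroup.of 0 *
    (FreeGroup.of 1 * FreeGroup.of 0 * FreeGroup.of 1)⁻¹}

/-- The braid group `B₃`. -/
abbrev BraidGroup3 : Type := PresentedGroup braidRels

/-- The bijection `(x₁, x₂, x₃) ↦ (-x₁, x₃ - x₁ x₂, x₂)` of `ℂ³`. -/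
def braidStep₁ : Equiv.Perm (Fin 3 → ℂ) where
  toFun x := ![-x 0, x 2 - x 0 * x 1, x 1]
  invFun y := ![-y 0, y 2, y 1 - y 0 * y 2]
  left_inv x := by
    funext i
    fin_cases i <;> simp
  right_inv y := by
    funext i
    fin_cases i <;> simp

/-- The bijection `(x₁, x₂, x₃) ↦ (x₃, -x₂, x₁ - x₂ x₃)` of `ℂ³`. -/
def braidStep₂ : Equiv.Perm (Fin 3 → ℂ) where
  toFun x := ![x 2, -x 1, x 0 - x 1 * x 2]
  invFun y := ![y 2 - y 1 * y 0, -y 1, y 0]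
  left_inv x := by
    funext i
    fin_cases i <;> simp
  right_inv y := by
    funext i
    fin_cases i <;> simp

theorem braidStep_relation :
    braidStep₁ * braidStep₂ * braidStep₁ = braidStep₂ * braidStep₁ * braidStep₂ := by
  ext x i
  fin_cases i <;> simp [braidStep₁, braidStep₂, Equiv.Perm.mul_apply] <;> ring

theorem braidRels_lift :
    ∀ r ∈ braidRels, FreeGroup.lift ![braidStep₁, braidStep₂] r = 1 := by
  intro r hr
  rw [Set.mem_singleton_iff.mp hr]
  simp only [map_mul, map_inv, FreeGroup.lift_apply_of, Matrix.cons_val_zero, Matrix.cons_val_one]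
  rw [braidStep_relation, mul_inv_cancel]

/-- The action of `B₃` on `ℂ³` in which `β₁` and `β₂` act by the two maps above. -/
def braidHom : BraidGroup3 →* Equiv.Perm (Fin 3 → ℂ) :=
  PresentedGroup.toGroup braidRels_lift

instance braidAction : MulAction BraidGroup3 (Fin 3 → ℂ) :=
  MulAction.compHom (Fin 3 → ℂ) braidHom

theorem braid_smul_one (x : Fin 3 → ℂ) :
    (PresentedGroup.of 0 : BraidGroup3) • x = ![-x 0, x 2 - x 0 * x 1, x 1] := by
  change braidHom (PresentedGroup.of 0) x = _
  rw [braidHom, PresentedGroup.toGroup.of]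
  rfl

theorem braid_smul_two (x : Fin 3 → ℂ) :
    (PresentedGroup.of 1 : BraidGroup3) • x = ![x 2, -x 1, x 0 - x 1 * x 2] := by
  change braidHom (PresentedGroup.of 1) x = _
  rw [braidHom, PresentedGroup.toGroup.of]
  rfl

/-- A triple is admissible if at most one of its coordinates is zero. -/
def IsAdmissible (x : Fin 3 → ℂ) : Prop :=
  ∀ i j, x i = 0 → x j = 0 → i = j

/-- Two triples are equivalent if they are equal up to a change of two signs. -/
def EquivalentTriples (x y : Fin 3 → ℂ) : Prop :=
  y = x ∨ y = ![-x 0, -x 1, x 2] ∨ y = ![-x 0, x 1, -x 2] ∨ y = ![x 0, -x 1, -x 2]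

/-- An admissible triple is good if every triple in its `B₃`-orbit has the form
`(-2 cos π r₁, -2 cos π r₂, -2 cos π r₃)` with rational `0 ≤ rᵢ ≤ 1`. -/
def IsGood (x : Fin 3 → ℂ) : Prop :=
  IsAdmissible x ∧ ∀ β : BraidGroup3, ∃ r : Fin 3 → ℚ,
    ∀ i, 0 ≤ r i ∧ r i ≤ 1 ∧ (β • x) i = ((-2 * Real.cos (Real.pi * (r i : ℝ)) : ℝ) : ℂ)

/-- The triple `(-2 cos a, -2 cos b, -2 cos c)`. -/
noncomputable def cosTriple (a b c : ℝ) : Fin 3 → ℂ :=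
  ![((-2 * Real.cos a : ℝ) : ℂ), ((-2 * Real.cos b : ℝ) : ℂ), ((-2 * Real.cos c : ℝ) : ℂ)]

open Real in
/-- The five representatives. -/
noncomputable def baseTriple : Fin 5 → (Fin 3 → ℂ) :=
  ![cosTriple (π / 2) (π / 3) (π / 3),
    cosTriple (π / 2) (π / 3) (π / 4),
    cosTriple (π / 2) (π / 3) (π / 5),
    cosTriple (π / 2) (π / 3) (2 * π / 5),
    cosTriple (π / 2) (π / 5) (2 * π / 5)]

open Real in
/-- The further triples listed for each of the five orbits. -/
noncomputable def furtherTriples : Fin 5 → Set (Fin 3 → ℂ) :=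
  ![{fun _ => ((2 * cos (π / 3) : ℝ) : ℂ)},
    {cosTriple (2 * π / 3) (π / 4) (π / 4)},
    {cosTriple (2 * π / 3) (π / 5) (π / 5),
      cosTriple (4 * π / 5) (4 * π / 5) (4 * π / 5)},
    {cosTriple (2 * π / 3) (2 * π / 5) (2 * π / 5),
      cosTriple (2 * π / 5) (2 * π / 5) (2 * π / 5)},
    {cosTriple (3 * π / 5) (π / 3) (π / 5),
      cosTriple (2 * π / 5) (π / 3) (π / 3),
      cosTriple (2 * π / 3) (π / 3) (π / 5)}]

/-! Let `x` be good with cubic form different from 4, and write `x 0 = ζ + ζ⁻¹`. Up to signs, the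
powers of `β₁⁻¹` replace `(x 1, x 2)` by consecutive terms of the recurrence `v (k + 2) = x 0 * v (k
+ 1) - v k`, so every `v k` is twice the cosine of a rational multiple of π. Put `Q = v 0 ^ 2 + v 1
^ 2 - x 0 * v 0 * v 1` and `D = 4 - x 0 ^ 2`; then `Q - D` is the cubic form minus 4.

The crux is that `ζ ^ 2` has order `n ≤ 5` (`order_le_five`). Suppose `n ≥ 6`. Under every embedding
of a number field containing `ζ`, `v 0` and `v 1`, the conjugates of the `v k` are real and lie in
`[-2, 2]`. Averaging their even powers over a period gives `Q = p * D` with `0 ≤ p ≤ 6/5`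
(`invariant_bound`), hence `|p * (p - 1)| ≤ 1/4`. The algebraic integer `(Q - D) * Q = p * (p - 1) *
D ^ 2` is nonzero: `Q ≠ D` by the hypothesis on the cubic form, `Q ≠ 0` by admissibility. Since `|D|
= |ζ ^ 2 - 1| ^ 2`, its norm is at most `N(ζ ^ 2 - 1) ^ 4 / 4 ^ d` in absolute value, where `d` is
the degree of the field. The value at 1 of the `n`-th cyclotomic polynomial makes this less than 1,
which is absurd. The factor `Q` is essential: `|p - 1|` alone need not be small.

If `n = 1` the recurrence grows linearly unless `Q = D`. So `2 ≤ n ≤ 5`, and every coordinate of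
every triple in the orbit is one of nine numbers in `ℤ[√2, φ]`. Exact computation on the 729 triples
completes the classification (`alphabet_cases`). The orbits are told apart by the cubic form, and in
one case by the squares of the coordinates. -/

/-! ### Sums of a root of unity and its inverse. -/

/-- `z` is the sum of a root of unity and its inverse. -/
def IsTwoCos (z : ℂ) : Prop :=
  ∃ m : ℕ, 0 < m ∧ ∃ ξ : ℂ, ξ ^ m = 1 ∧ z = ξ + ξ⁻¹

theorem IsTwoCos.exists_real {z : ℂ} (hz : IsTwoCos z) : ∃ s : ℝ, z = s ∧ |s| ≤ 2 := by
  obtain ⟨m, hm, ξ, hξ, rfl⟩ := hz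
  have hn : ‖ξ‖ = 1 := Complex.norm_eq_one_of_pow_eq_one hξ hm.ne'
  refine ⟨2 * ξ.re, ?_, ?_⟩
  · rw [Complex.inv_eq_conj hn, Complex.add_conj]
  · have := Complex.abs_re_le_norm ξ
    rw [abs_mul, abs_two]
    linarith

theorem IsTwoCos.isIntegral {z : ℂ} (hz : IsTwoCos z) : IsIntegral ℤ z := by
  obtain ⟨m, hm, ξ, hξ, rfl⟩ := hz
  refine IsIntegral.add (IsIntegral.of_pow hm (hξ ▸ isIntegral_one)) (IsIntegral.of_pow hm ?_)
  rw [inv_pow, hξ, inv_one]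
  exact isIntegral_one

/-- The Dickson polynomial of index `m` sends `ξ + ξ⁻¹` to `ξ ^ m + ξ⁻¹ ^ m`. So the property
amounts to a polynomial equation over the prime field, value 2, which any embedding preserves; `ξ`
itself need not lie in `K`. -/
theorem IsTwoCos.map {K : Type*} [Field K] (i ψ : K →+* ℂ) {α : K} (h : IsTwoCos (i α)) :
    IsTwoCos (ψ α) := by
  obtain ⟨m, hm, ξ, hξ, hα⟩ := h
  have hξ0 : ξ ≠ 0 := by
    rintro rfl
    rw [zero_pow hm.ne'] at hξ
    exact zero_ne_one hξ
  have h1 : (Polynomial.dickson 1 (1 : K) m).eval α = 2 := by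
    apply i.injective
    rw [← Polynomial.eval_map_apply, Polynomial.map_dickson, map_one, hα,
      Polynomial.dickson_one_one_eval_add_inv _ _ (mul_inv_cancel₀ hξ0), inv_pow, hξ, map_ofNat]
    norm_num
  -- `s ^ 2` is the discriminant of `t ^ 2 - ψ α * t + 1`, whose roots are the sought root of unity
  -- and its inverse.
  obtain ⟨s, hs⟩ := IsAlgClosed.exists_pow_nat_eq (ψ α ^ 2 - 4) (zero_lt_two)
  have hmul : (ψ α + s) / 2 * ((ψ α - s) / 2) = 1 := by
    linear_combination (-1 / 4 : ℂ) * hs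
  have hadd : ψ α = (ψ α + s) / 2 + (ψ α - s) / 2 := by ring
  have h2 := congrArg ψ h1
  rw [← Polynomial.eval_map_apply, Polynomial.map_dickson, map_one, hadd,
      Polynomial.dickson_one_one_eval_add_inv _ _ hmul, map_ofNat] at h2
  have hpow := congrArg (· ^ m) hmul
  simp only [mul_pow, one_pow] at hpow
  refine ⟨m, hm, (ψ α + s) / 2, ?_, ?_⟩
  · have : (((ψ α + s) / 2) ^ m - 1) ^ 2 = 0 := by
      linear_combination ((ψ α + s) / 2) ^ m * h2 - hpow
    exact sub_eq_zero.mp (pow_eq_zero_iff two_ne_zero |>.mp this)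
  · rw [inv_eq_of_mul_eq_one_right hmul]
    exact hadd

/-! ### Moments of a linear recurrence. -/

theorem sum_pow_eq_zero {W : ℂ} {n : ℕ} (hW : IsPrimitiveRoot W n) {j : ℕ} (hj : 0 < j)
    (hjn : j < n) : ∑ k ∈ Finset.range n, W ^ (j * k) = 0 := by
  have h1 : W ^ j ≠ 1 := hW.pow_ne_one_of_pos_of_lt hj.ne' hjn
  have h2 := geom_sum_mul (W ^ j) n
  rw [← pow_mul, mul_comm j n, pow_mul, hW.pow_eq_one, one_pow, sub_self] at h2
  simp_rw [pow_mul]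
  exact (mul_eq_zero.mp h2).resolve_right (sub_ne_zero.mpr h1)

theorem recurrence_solution {w : ℂ} (hw : w ≠ 0) (hw2 : w ^ 2 ≠ 1) {v : ℕ → ℂ}
    (hrec : ∀ k, v (k + 2) = (w + w⁻¹) * v (k + 1) - v k) :
    ∃ A B : ℂ, (∀ k, v k = A * w ^ k + B * w⁻¹ ^ k) ∧
      v 0 ^ 2 + v 1 ^ 2 - (w + w⁻¹) * v 0 * v 1 = A * B * (4 - (w + w⁻¹) ^ 2) := by
  have hd : w - w⁻¹ ≠ 0 := by
    intro h
    apply hw2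
    field_simp at h
    linear_combination h
  have hwi : w * w⁻¹ = 1 := mul_inv_cancel₀ hw
  have hdd : (w - w⁻¹) * (w - w⁻¹)⁻¹ = 1 := mul_inv_cancel₀ hd
  generalize (w - w⁻¹)⁻¹ = e at hdd
  generalize w⁻¹ = u at *
  refine ⟨(v 1 - u * v 0) * e, (w * v 0 - v 1) * e, ?_, ?_⟩
  · have key : ∀ k, v k = (v 1 - u * v 0) * e * w ^ k + (w * v 0 - v 1) * e * u ^ k ∧
        v (k + 1) = (v 1 - u * v 0) * e * w ^ (k + 1) + (w * v 0 - v 1) * e * u ^ (k + 1) := by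
      intro k
      induction k with
      | zero =>
        constructor
        · simp only [pow_zero, mul_one]
          linear_combination (-v 0) * hdd
        · simp only [zero_add, pow_one]
          linear_combination (-v 1) * hdd
      | succ k ih =>
        refine ⟨ih.2, ?_⟩
        rw [hrec, ih.1, ih.2]
        simp only [pow_succ]
        linear_combination ((v 1 - u * v 0) * e * w ^ k + (w * v 0 - v 1) * e * u ^ k) * hwi
    exact fun k => (key k).1
  · linear_combination (v 1 - u * v 0) * (w * v 0 - v 1) * ((w - u) * e + 1) * hdd -
      (v 0 ^ 2 - 4 * ((v 1 - u * v 0) * (w * v 0 - v 1)) * e ^ 2) * hwi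

/-- With `v k = A * w ^ k + B * w⁻¹ ^ k`, only the constant terms of `v k ^ 2`, `v k ^ 4`, `v k ^ 6`
survive averaging over `k < n`, giving `2p`, `6p²`, `20p³` for `p = A * B`. The sixth power involves
`w ^ 2` to the third power, whence `4 ≤ n`. -/
theorem invariant_bound {w : ℂ} {n : ℕ} (hn : 4 ≤ n) (hw : IsPrimitiveRoot (w ^ 2) n) {v : ℕ → ℂ}
    (hrec : ∀ k, v (k + 2) = (w + w⁻¹) * v (k + 1) - v k)
    (hv : ∀ k, ∃ s : ℝ, v k = s ∧ |s| ≤ 2) :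
    ∃ p : ℝ, 0 ≤ p ∧ p ≤ 6 / 5 ∧ (p = 0 → v 0 = 0 ∧ v 1 = 0) ∧
      v 0 ^ 2 + v 1 ^ 2 - (w + w⁻¹) * v 0 * v 1 = p * (4 - (w + w⁻¹) ^ 2) := by
  have hw2 : w ^ 2 ≠ 1 := hw.ne_one (by omega)
  have hw0 : w ≠ 0 := by
    rintro rfl
    exact hw.ne_zero (by omega) (by simp)
  obtain ⟨A, B, hAB, hQ⟩ := recurrence_solution hw0 hw2 hrec
  choose s hs hs2 using hv
  have hwi : w * w⁻¹ = 1 := mul_inv_cancel₀ hw0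
  have hwik : ∀ k, w ^ k * w⁻¹ ^ k = 1 := fun k => by rw [← mul_pow, hwi, one_pow]
  have S : ∀ j, 0 < j → j < n → ∑ k ∈ Finset.range n, (w ^ k) ^ (2 * j) = 0 := by
    intro j hj hjn
    rw [← sum_pow_eq_zero hw hj hjn]
    refine Finset.sum_congr rfl fun k _ => ?_
    rw [← pow_mul, ← pow_mul]
    congr 1
    ring
  have S' : ∀ j, 0 < j → j < n → ∑ k ∈ Finset.range n, (w⁻¹ ^ k) ^ (2 * j) = 0 := by
    intro j hj hjn
    have hwinv : IsPrimitiveRoot (w⁻¹ ^ 2) n := by rw [inv_pow]; exact hw.inv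
    rw [← sum_pow_eq_zero hwinv hj hjn]
    refine Finset.sum_congr rfl fun k _ => ?_
    rw [← pow_mul, ← pow_mul]
    congr 1
    ring
  have h2 : ∑ k ∈ Finset.range n, v k ^ 2 = 2 * n * (A * B) := by
    have : ∀ k, v k ^ 2 = A ^ 2 * (w ^ k) ^ (2 * 1) + B ^ 2 * (w⁻¹ ^ k) ^ (2 * 1) + 2 * (A * B) := by
      intro k
      rw [hAB]
      linear_combination (2 * A * B) * hwik k
    simp_rw [this, Finset.sum_add_distrib, ← Finset.mul_sum]
    rw [S 1 (by omega) (by omega), S' 1 (by omega) (by omega)]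
    simp
    ring
  have h4 : ∑ k ∈ Finset.range n, v k ^ 4 = 6 * n * (A * B) ^ 2 := by
    have : ∀ k, v k ^ 4 = A ^ 4 * (w ^ k) ^ (2 * 2) + B ^ 4 * (w⁻¹ ^ k) ^ (2 * 2) +
        4 * A ^ 3 * B * (w ^ k) ^ (2 * 1) + 4 * A * B ^ 3 * (w⁻¹ ^ k) ^ (2 * 1)
         + 6 * (A * B) ^ 2 := by
      intro k
      rw [hAB]
      have := hwik k
      generalize w ^ k = a at *
      generalize w⁻¹ ^ k = b at *
      linear_combination (4 * A ^ 3 * B * a ^ 2 + 4 * A * B ^ 3 * b ^ 2 +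
        6 * A ^ 2 * B ^ 2 * (a * b + 1)) * this
    simp_rw [this, Finset.sum_add_distrib, ← Finset.mul_sum]
    rw [S 1 (by omega) (by omega), S' 1 (by omega) (by omega), S 2 (by omega) (by omega),
      S' 2 (by omega) (by omega)]
    simp
    ring
  have h6 : ∑ k ∈ Finset.range n, v k ^ 6 = 20 * n * (A * B) ^ 3 := by
    have : ∀ k, v k ^ 6 = A ^ 6 * (w ^ k) ^ (2 * 3) + B ^ 6 * (w⁻¹ ^ k) ^ (2 * 3) +
        6 * A ^ 5 * B * (w ^ k) ^ (2 * 2) + 6 * A * B ^ 5 * (w⁻¹ ^ k) ^ (2 * 2) +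
        15 * A ^ 4 * B ^ 2 * (w ^ k) ^ (2 * 1) + 15 * A ^ 2 * B ^ 4 * (w⁻¹ ^ k) ^ (2 * 1)
         + 20 * (A * B) ^ 3 := by
      intro k
      rw [hAB]
      have := hwik k
      generalize w ^ k = a at *
      generalize w⁻¹ ^ k = b at *
      linear_combination (6 * A ^ 5 * B * a ^ 4 + 6 * A * B ^ 5 * b ^ 4 +
        15 * (A ^ 4 * B ^ 2 * a ^ 2 + A ^ 2 * B ^ 4 * b ^ 2) * (a * b + 1) +
        20 * A ^ 3 * B ^ 3 * (a ^ 2 * b ^ 2 + a * b + 1)) * this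
    simp_rw [this, Finset.sum_add_distrib, ← Finset.mul_sum]
    rw [S 1 (by omega) (by omega), S' 1 (by omega) (by omega), S 2 (by omega) (by omega),
      S' 2 (by omega) (by omega), S 3 (by omega) (by omega), S' 3 (by omega) (by omega)]
    simp
    ring
  have hn0 : (0 : ℝ) < n := by exact_mod_cast (by omega : 0 < n)
  set p : ℝ := (∑ k ∈ Finset.range n, s k ^ 2) / (2 * n) with hp
  have hpAB : (p : ℂ) = A * B := by
    have hnC : (n : ℂ) ≠ 0 := by exact_mod_cast hn0.ne'
    rw [hp]
    push_cast
    simp_rw [← hs]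
    rw [h2]
    field_simp
  have hp0 : 0 ≤ p := by positivity
  -- The later estimate `p * (p - 1) ≤ 1/4` needs `p ≤ (1 + √2)/2 ≈ 1.207`. The weight `s ^ 2` in
  -- place of `s ^ 4` would give only `p ≤ 4/3`.
  have h24 : 0 ≤ (n : ℝ) * (24 * p ^ 2 - 20 * p ^ 3) := by
    have : ((∑ k ∈ Finset.range n, s k ^ 4 * (4 - s k ^ 2) : ℝ) : ℂ) =
        ((n : ℝ) * (24 * p ^ 2 - 20 * p ^ 3) : ℝ) := by
      push_cast
      simp_rw [← hs]
      rw [hpAB]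
      have : ∀ k, v k ^ 4 * (4 - v k ^ 2) = 4 * v k ^ 4 - v k ^ 6 := fun k => by ring
      simp_rw [this]
      rw [Finset.sum_sub_distrib, ← Finset.mul_sum, h4, h6]
      ring
    rw [← Complex.ofReal_injective this]
    refine Finset.sum_nonneg fun k _ => mul_nonneg (by positivity) ?_
    have := sq_le_sq' (abs_le.mp (hs2 k)).1 (abs_le.mp (hs2 k)).2
    linarith
  refine ⟨p, hp0, ?_, ?_, ?_⟩
  · by_contra! h
    have h1 : 0 ≤ 24 * p ^ 2 - 20 * p ^ 3 := nonneg_of_mul_nonneg_right h24 hn0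
    have : 0 < p ^ 2 := by positivity
    nlinarith
  · intro h0
    have : ∑ k ∈ Finset.range n, s k ^ 2 = 0 := by
      rw [hp, div_eq_zero_iff] at h0
      exact h0.resolve_right (by positivity)
    rw [Finset.sum_eq_zero_iff_of_nonneg fun k _ => sq_nonneg _] at this
    have z := fun k hk => pow_eq_zero_iff (two_ne_zero) |>.mp (this k (Finset.mem_range.mpr hk))
    rw [hs 0, hs 1, z 0 (by omega), z 1 (by omega)]
    simp
  · rw [hQ, hpAB]

/-! ### Norms of `ω - 1` and of algebraic integers. -/

/-- The value is `p` when `n` is a power of a prime `p`, and 1 for the other `n` in range. The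
inequality fails at `n = 5`, where it would read `25 < 16`. -/
theorem eval_one_cyclotomic_sq_lt {n : ℕ} (hn : 6 ≤ n) :
    ((Polynomial.cyclotomic n ℤ).eval 1) ^ 2 < 2 ^ n.totient := by
  by_cases hpp : IsPrimePow n
  · obtain ⟨p, k, hp, hk, rfl⟩ := (isPrimePow_nat_iff n).mp hpp
    obtain ⟨k, rfl⟩ := Nat.exists_eq_succ_of_ne_zero hk.ne'
    have := Fact.mk hp
    rw [Nat.succ_eq_add_one, Polynomial.eval_one_cyclotomic_prime_pow,
      Nat.totient_prime_pow_succ hp]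
    rw [Nat.succ_eq_add_one] at hn
    have hp2 := hp.two_le
    have hmain : p ^ 2 < 2 ^ (p ^ k * (p - 1)) := by
      by_cases h7 : 7 ≤ p
      · have h1 : ∀ q : ℕ, 7 ≤ q → q ^ 2 < 2 ^ (q - 1) := by
          intro q hq
          induction q, hq using Nat.le_induction with
          | base => norm_num
          | succ q hq ih =>
            obtain ⟨r, rfl⟩ := Nat.exists_eq_add_of_le hq
            have e1 : 7 + r + 1 - 1 = (7 + r - 1) + 1 := by omega
            rw [e1, pow_succ 2]
            nlinarith
        refine (h1 p h7).trans_le (Nat.pow_le_pow_right (by norm_num) ?_)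
        exact Nat.le_mul_of_pos_left _ (by positivity)
      -- Here `n = p ^ (k + 1)`, so `n ≥ 6` excludes the small exponents for which the inequality
      -- fails.
      · have hcases : p = 2 ∨ p = 3 ∨ p = 5 := by
          interval_cases p <;> first | omega | (exfalso; revert hp; norm_num)
        rcases hcases with rfl | rfl | rfl
        · have h2 : 2 ≤ k := by
            by_contra! h
            interval_cases k <;> norm_num at hn
          have : 2 ^ 2 ≤ 2 ^ k := Nat.pow_le_pow_right (by norm_num) h2
          calc 2 ^ 2 < 2 ^ 4 := by norm_num
            _ ≤ _ := Nat.pow_le_pow_right (by norm_num) (by omega)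
        · have h2 : 1 ≤ k := by
            by_contra! h
            interval_cases k; norm_num at hn
          have : 3 ^ 1 ≤ 3 ^ k := Nat.pow_le_pow_right (by norm_num) h2
          calc 3 ^ 2 < 2 ^ 6 := by norm_num
            _ ≤ _ := Nat.pow_le_pow_right (by norm_num) (by omega)
        · have h2 : 1 ≤ k := by
            by_contra! h
            interval_cases k; norm_num at hn
          have : 5 ^ 1 ≤ 5 ^ k := Nat.pow_le_pow_right (by norm_num) h2
          calc 5 ^ 2 < 2 ^ 20 := by norm_num
            _ ≤ _ := Nat.pow_le_pow_right (by norm_num) (by omega)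
    exact_mod_cast hmain
  · rw [Polynomial.eval_one_cyclotomic_not_prime_pow]
    · have : n.totient ≠ 0 := (Nat.totient_pos.mpr (by omega)).ne'
      rw [one_pow]
      exact one_lt_pow₀ (by norm_num) this
    · intro p hp k hk
      apply hpp
      rw [isPrimePow_nat_iff]
      refine ⟨p, k, hp, Nat.pos_of_ne_zero ?_, hk⟩
      rintro rfl
      rw [pow_zero] at hk
      omega

-- The norm is the cyclotomic value at 1 raised to the power `[K : ℚ(ω)]`; the bound follows from
-- the preceding one by multiplicativity of degrees.
open IntermediateField in
theorem norm_sub_one_pow_lt {K : Type*} [Field K] [NumberField K] {n : ℕ} (hn : 6 ≤ n) {ω : K}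
    (hω : IsPrimitiveRoot ω n) :
    (Algebra.norm ℚ (ω - 1)) ^ 4 < 4 ^ Module.finrank ℚ K := by
  have h0 : NeZero n := ⟨by omega⟩
  have : IsCyclotomicExtension {n} ℚ ℚ⟮ω⟯ := hω.intermediateField_adjoin_isCyclotomicExtension ℚ
  have hg : IsPrimitiveRoot (AdjoinSimple.gen ℚ ω) n := by
    rw [← IsPrimitiveRoot.map_iff_of_injective (algebraMap ℚ⟮ω⟯ K).injective]
    exact hω
  have hirr := Polynomial.cyclotomic.irreducible_rat (n := n) (by omega)
  have h1 := hg.sub_one_norm_eq_eval_cyclotomic (K := ℚ) (by omega) hirr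
  have hfr : Module.finrank ℚ ℚ⟮ω⟯ = n.totient :=
    IsCyclotomicExtension.finrank ℚ⟮ω⟯ hirr
  have h2 : Algebra.norm ℚ (ω - 1) =
      (((Polynomial.cyclotomic n ℤ).eval 1 : ℤ) : ℚ) ^ Module.finrank ℚ⟮ω⟯ K := by
    rw [← Algebra.norm_norm (S := ℚ⟮ω⟯)]
    have : ω - 1 = algebraMap ℚ⟮ω⟯ K (AdjoinSimple.gen ℚ ω - 1) := by
      rw [map_sub, map_one]; rfl
    rw [this, Algebra.norm_algebraMap, map_pow, h1]
  have hlt : (((Polynomial.cyclotomic n ℤ).eval 1 : ℤ) : ℚ) ^ 2 < 2 ^ n.totient := by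
    exact_mod_cast eval_one_cyclotomic_sq_lt hn
  rw [h2, ← Module.finrank_mul_finrank ℚ ℚ⟮ω⟯ K, hfr, ← pow_mul, mul_comm _ 4, pow_mul, pow_mul]
  refine pow_lt_pow_left₀ ?_ (by positivity) Module.finrank_pos.ne'
  calc _ = ((((Polynomial.cyclotomic n ℤ).eval 1 : ℤ) : ℚ) ^ 2) ^ 2 := by ring
    _ < (2 ^ n.totient) ^ 2 := pow_lt_pow_left₀ hlt (by positivity) two_ne_zero
    _ = _ := by rw [← pow_mul, mul_comm, pow_mul]; norm_num

theorem one_le_prod_norm_embeddings {K : Type*} [Field K] [NumberField K] {β : K} (hβ : β ≠ 0)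
    (hint : IsIntegral ℤ β) : 1 ≤ ∏ σ : K →ₐ[ℚ] ℂ, ‖σ β‖ := by
  have h1 := Algebra.norm_eq_prod_embeddings ℚ ℂ β
  obtain ⟨z, hz⟩ := IsIntegrallyClosed.isIntegral_iff.mp (Algebra.isIntegral_norm ℚ hint)
  have hz0 : z ≠ 0 := by
    rintro rfl
    rw [map_zero] at hz
    exact hβ (Algebra.norm_eq_zero_iff.mp hz.symm)
  rw [← norm_prod, ← h1, ← hz]
  have : (1 : ℝ) ≤ |(z : ℝ)| := by exact_mod_cast Int.one_le_abs hz0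
  simpa using this

/-! ### The bound on the order of `ζ ^ 2`. -/

/-- If all terms of a nondegenerate linear recurrence with multiplier `ζ + ζ⁻¹` are sums of a root
of unity and its inverse, then `ζ ^ 2` has order between `2` and `5`. -/
theorem order_le_five {ζ : ℂ} {m : ℕ} (hm : 0 < m) (hζ : ζ ^ m = 1) {v : ℕ → ℂ}
    (hrec : ∀ k, v (k + 2) = (ζ + ζ⁻¹) * v (k + 1) - v k) (hv : ∀ k, IsTwoCos (v k))
    (hε : v 0 ^ 2 + v 1 ^ 2 - (ζ + ζ⁻¹) * v 0 * v 1 + (ζ + ζ⁻¹) ^ 2 - 4 ≠ 0)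
    (hne : ¬ (v 0 = 0 ∧ v 1 = 0)) :
    ∃ n, 2 ≤ n ∧ n ≤ 5 ∧ IsPrimitiveRoot (ζ ^ 2) n := by
  have hζ0 : ζ ≠ 0 := by
    rintro rfl
    rw [zero_pow hm.ne'] at hζ
    exact zero_ne_one hζ
  have hprim := IsPrimitiveRoot.orderOf (ζ ^ 2)
  have hpos : 0 < orderOf (ζ ^ 2) :=
    orderOf_pos_iff.mpr (isOfFinOrder_iff_pow_eq_one.mpr
      ⟨m, hm, by rw [← pow_mul, mul_comm, pow_mul, hζ, one_pow]⟩)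
  generalize orderOf (ζ ^ 2) = n at *
  refine ⟨n, ?_, ?_, hprim⟩
  · by_contra! hlt
    obtain rfl : n = 1 := by omega
    rw [IsPrimitiveRoot.one_right_iff] at hprim
    have hinv : ζ⁻¹ = ζ := inv_eq_of_mul_eq_one_right (by rw [← sq, hprim])
    have hmul : ζ * ζ = 1 := by rw [← sq, hprim]
    rw [hinv] at hrec hε
    -- Now `ζ = ±1` is a double characteristic root. Boundedness of `v` kills the linear term, and
    -- `v 0 = ζ * v 1` contradicts `hε`.
    have key : ∀ k : ℕ, v k = ζ ^ k * (v 0 + k * (ζ * v 1 - v 0)) ∧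
        v (k + 1) = ζ ^ (k + 1) * (v 0 + (k + 1) * (ζ * v 1 - v 0)) := by
      intro k
      induction k with
      | zero =>
        simp only [Nat.cast_zero, pow_zero, zero_mul, zero_add, pow_one, one_mul, add_zero, true_and]
        linear_combination (- v 1) * hmul
      | succ k ih =>
        refine ⟨by rw [ih.2]; push_cast; ring, ?_⟩
        rw [hrec, ih.1, ih.2]
        push_cast
        simp only [pow_succ]
        linear_combination (-(v 0 + (k : ℂ) * (ζ * v 1 - v 0)) * ζ ^ k * (-1)) * hmul
    have hnormζ : ‖ζ‖ = 1 := Complex.norm_eq_one_of_pow_eq_one hζ hm.ne'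
    have hb : ∀ k, ‖v k‖ ≤ 2 := by
      intro k
      obtain ⟨s, hs, hs2⟩ := (hv k).exists_real
      rw [hs]
      simpa using hs2
    have hdiff : ζ * v 1 - v 0 = 0 := by
      by_contra hd
      obtain ⟨k, hk⟩ := exists_nat_gt (4 / ‖ζ * v 1 - v 0‖)
      rw [div_lt_iff₀ (norm_pos_iff.mpr hd)] at hk
      have h1 := hb k
      rw [(key k).1, norm_mul, norm_pow, hnormζ, one_pow, one_mul] at h1
      have h2 := norm_sub_le (v 0 + k * (ζ * v 1 - v 0)) (v 0)
      rw [add_sub_cancel_left, norm_mul, Complex.norm_natCast] at h2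
      linarith [hb 0]
    apply hε
    linear_combination (4 - v 1 ^ 2) * hmul + (ζ * v 1 - v 0) * hdiff
  · by_contra! hlt
    -- Adjoining `ζ` and not only `ζ + ζ⁻¹` puts `ζ ^ 2 - 1` in `K`, so that its norm can be used.
    let K := IntermediateField.adjoin ℚ ({ζ, v 0, v 1} : Set ℂ)
    have hζint : IsIntegral ℤ ζ := IsIntegral.of_pow hm (hζ ▸ isIntegral_one)
    have : FiniteDimensional ℚ K := by
      apply IntermediateField.finiteDimensional_adjoin
      rintro x (rfl | rfl | rfl)
      · exact hζint.tower_top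
      · exact (hv 0).isIntegral.tower_top
      · exact (hv 1).isIntegral.tower_top
    have : NumberField K := { to_charZero := inferInstance, to_finiteDimensional := inferInstance }
    let i : K →+* ℂ := algebraMap K ℂ
    obtain ⟨Z, hZ⟩ : ∃ Z : K, i Z = ζ :=
      ⟨⟨ζ, IntermediateField.subset_adjoin _ _ (by simp)⟩, rfl⟩
    obtain ⟨V0, hV0⟩ : ∃ Z : K, i Z = v 0 :=
      ⟨⟨v 0, IntermediateField.subset_adjoin _ _ (by simp)⟩, rfl⟩
    obtain ⟨V1, hV1⟩ : ∃ Z : K, i Z = v 1 :=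
      ⟨⟨v 1, IntermediateField.subset_adjoin _ _ (by simp)⟩, rfl⟩
    obtain ⟨V, hV⟩ : ∃ V : ℕ → K, ∀ k, i (V k) = v k := by
      have : ∀ k, (∃ a, i a = v k) ∧ ∃ a, i a = v (k + 1) := by
        intro k
        induction k with
        | zero => exact ⟨⟨V0, hV0⟩, ⟨V1, hV1⟩⟩
        | succ k ih =>
          obtain ⟨⟨a, ha⟩, b, hb⟩ := ih
          refine ⟨⟨b, hb⟩, (Z + Z⁻¹) * b - a, ?_⟩
          rw [hrec, map_sub, map_mul, map_add, map_inv₀, hZ, hb, ha]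
      choose V hV using fun k => (this k).1
      exact ⟨V, hV⟩
    have hZ2 : IsPrimitiveRoot (Z ^ 2) n := by
      rw [← IsPrimitiveRoot.map_iff_of_injective i.injective, map_pow, hZ]
      exact hprim
    have hVrec : ∀ k, V (k + 2) = (Z + Z⁻¹) * V (k + 1) - V k := by
      intro k
      apply i.injective
      simp only [map_sub, map_mul, map_add, map_inv₀, hZ, hV, hrec]
    let Q : K := V 0 ^ 2 + V 1 ^ 2 - (Z + Z⁻¹) * V 0 * V 1
    let D : K := 4 - (Z + Z⁻¹) ^ 2
    have hbound : ∀ σ : K →+* ℂ, ∃ p : ℝ, 0 ≤ p ∧ p ≤ 6 / 5 ∧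
        (p = 0 → σ (V 0) = 0 ∧ σ (V 1) = 0) ∧ σ Q = p * σ D := by
      intro σ
      have := invariant_bound (w := σ Z) (n := n) (v := fun k => σ (V k)) (by omega)
        (by rw [← map_pow]; exact hZ2.map_of_injective σ.injective)
        (fun k => by simp only [hVrec, map_sub, map_mul, map_add, map_inv₀])
        (fun k => (IsTwoCos.map i σ (by rw [hV]; exact hv k)).exists_real)
      simpa only [Q, D, map_sub, map_mul, map_add, map_inv₀, map_pow, map_ofNat] using this
    have hZ0 : Z ≠ 0 := by
      rintro rfl
      exact hζ0 (by rw [← hZ, map_zero])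
    have hDeq : D = -Z⁻¹ ^ 2 * (Z ^ 2 - 1) ^ 2 := by
      simp only [D]
      field_simp
      ring
    have hD0 : D ≠ 0 := by
      rw [hDeq]
      exact mul_ne_zero (neg_ne_zero.mpr (pow_ne_zero _ (inv_ne_zero hZ0)))
        (pow_ne_zero _ (sub_ne_zero.mpr (hZ2.ne_one (by omega))))
    have hQ0 : Q ≠ 0 := by
      intro hQ
      obtain ⟨p, -, -, hp, hpQ⟩ := hbound i
      rw [hQ, map_zero, eq_comm, mul_eq_zero] at hpQ
      have hp0 : p = 0 := by
        rcases hpQ with h | h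
        · exact_mod_cast h
        · exact absurd ((map_eq_zero i).mp h) hD0
      have := hp hp0
      rw [hV, hV] at this
      exact hne this
    have hE0 : Q - D ≠ 0 := by
      intro h
      apply hε
      have := congrArg i h
      simp only [Q, D, map_sub, map_mul, map_add, map_inv₀, map_pow, map_ofNat, hZ, hV,
        map_zero] at this
      linear_combination this
    have hiint : ∀ a : K, IsIntegral ℤ (i a) → IsIntegral ℤ a := fun a ha =>
      (isIntegral_algebraMap_iff (A := K) (B := ℂ) i.injective).mp ha
    have hX : IsIntegral ℤ (Z + Z⁻¹) := by
      apply hiint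
      rw [map_add, map_inv₀, hZ]
      exact IsTwoCos.isIntegral ⟨m, hm, ζ, hζ, rfl⟩
    have hVint : ∀ k, IsIntegral ℤ (V k) := fun k => hiint _ (by rw [hV]; exact (hv k).isIntegral)
    have h4 : IsIntegral ℤ (4 : K) := by
      have := isIntegral_algebraMap (R := ℤ) (A := K) (x := 4)
      simpa using this
    have hQint : IsIntegral ℤ Q :=
      (((hVint 0).pow 2).add ((hVint 1).pow 2)).sub ((hX.mul (hVint 0)).mul (hVint 1))
    have hDint : IsIntegral ℤ D := h4.sub (hX.pow 2)
    have h1 := one_le_prod_norm_embeddings (mul_ne_zero hE0 hQ0) ((hQint.sub hDint).mul hQint)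
    have hZm : Z ^ m = 1 := i.injective (by rw [map_pow, hZ, hζ, map_one])
    have hσ : ∀ σ : K →ₐ[ℚ] ℂ, ‖σ ((Q - D) * Q)‖ ≤ ‖σ (Z ^ 2 - 1)‖ ^ 4 / 4 := by
      intro σ
      obtain ⟨p, hp0, hp1, -, hpQ⟩ := hbound σ
      replace hpQ : σ Q = p * σ D := hpQ
      have hnZ : ‖σ Z‖ = 1 :=
        Complex.norm_eq_one_of_pow_eq_one (by rw [← map_pow, hZm, map_one]) hm.ne'
      have hD' : ‖σ D‖ = ‖σ (Z ^ 2 - 1)‖ ^ 2 := by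
        rw [hDeq]
        simp [hnZ]
      have e : σ ((Q - D) * Q) = ((p - 1) * p : ℝ) * (σ D) ^ 2 := by
        rw [map_mul, map_sub, hpQ]
        push_cast
        ring
      rw [e, norm_mul, norm_pow, hD', Complex.norm_real, Real.norm_eq_abs, ← pow_mul]
      -- The minimum `-1/4` is at `p = 1/2`; at the end `p = 6/5` the value is `6/25`.
      have : |(p - 1) * p| ≤ 1 / 4 := by
        rw [abs_le]
        constructor <;> nlinarith [sq_nonneg (p - 1 / 2)]
      nlinarith [pow_nonneg (norm_nonneg (σ (Z ^ 2 - 1))) 4]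
    have h2 := h1.trans (Finset.prod_le_prod (fun σ _ => norm_nonneg _) fun σ _ => hσ σ)
    rw [Finset.prod_div_distrib, Finset.prod_pow, Finset.prod_const, Finset.card_univ,
      AlgHom.card, ← norm_prod, ← Algebra.norm_eq_prod_embeddings ℚ ℂ,
      le_div_iff₀ (by positivity), one_mul] at h2
    have h3 := norm_sub_one_pow_lt hlt hZ2
    rw [eq_ratCast, Complex.norm_ratCast, ← abs_pow, abs_of_nonneg (by positivity)] at h2
    have h3' : ((Algebra.norm ℚ (Z ^ 2 - 1) : ℚ) : ℝ) ^ 4 < 4 ^ Module.finrank ℚ K := by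
      exact_mod_cast h3
    linarith

/-! ### The nine possible coordinates. -/

open Real in
/-- The numbers `0, ±1, ±√2, ±φ, ±φ⁻¹`, with `φ` the golden ratio. -/
def smallCosines : Set ℂ :=
  {z | z = 0 ∨ z = 1 ∨ z = -1 ∨ z = (√2 : ℝ) ∨ z = -(√2 : ℝ) ∨ z = (goldenRatio : ℝ) ∨
    z = -(goldenRatio : ℝ) ∨ z = (goldenRatio : ℝ) - 1 ∨ z = 1 - (goldenRatio : ℝ)}

theorem goldenRatio_sq_complex : ((Real.goldenRatio : ℝ) : ℂ) ^ 2 = (Real.goldenRatio : ℝ) + 1 := by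
  exact_mod_cast Real.goldenRatio_sq

theorem sqrt_two_sq_complex : ((√2 : ℝ) : ℂ) ^ 2 = 2 := by
  exact_mod_cast Real.sq_sqrt (show (0 : ℝ) ≤ 2 by norm_num)

theorem mem_smallCosines {ζ : ℂ} {n : ℕ} (h2 : 2 ≤ n) (h5 : n ≤ 5)
    (h : IsPrimitiveRoot (ζ ^ 2) n) : ζ + ζ⁻¹ ∈ smallCosines := by
  have hζ0 : ζ ≠ 0 := by
    rintro rfl
    exact h.ne_zero (by omega) (by simp)
  have hζ : ζ * ζ⁻¹ = 1 := mul_inv_cancel₀ hζ0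
  have hg := h.geom_sum_eq_zero (by omega)
  have hφ := goldenRatio_sq_complex
  have hs := sqrt_two_sq_complex
  have hpow : ∀ j, ζ ^ j ≠ 0 := fun j => pow_ne_zero j hζ0
  simp only [smallCosines, Set.mem_ofPred_eq]
  obtain rfl | rfl | rfl | rfl : n = 2 ∨ n = 3 ∨ n = 4 ∨ n = 5 := by omega
  · left
    simp only [Finset.sum_range_succ, Finset.sum_range_zero] at hg
    refine (mul_eq_zero.mp (?_ : ζ * _ = 0)).resolve_left hζ0
    linear_combination hg + hζ
  · have : (ζ + ζ⁻¹ - 1) * (ζ + ζ⁻¹ + 1) = 0 := by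
      refine (mul_eq_zero.mp (?_ : ζ ^ 2 * _ = 0)).resolve_left (hpow 2)
      simp only [Finset.sum_range_succ, Finset.sum_range_zero] at hg
      field_simp
      linear_combination hg
    rcases mul_eq_zero.mp this with h | h
    · right; left; linear_combination h
    · right; right; left; linear_combination h
  · have h4 : (ζ ^ 2 + 1) * (ζ ^ 4 + 1) = 0 := by
      simp only [Finset.sum_range_succ, Finset.sum_range_zero] at hg
      linear_combination hg
    have hne : ζ ^ 2 + 1 ≠ 0 := by
      intro h0
      apply h.pow_ne_one_of_pos_of_lt two_ne_zero (by norm_num)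
      linear_combination (ζ ^ 2 - 1) * h0
    have h4' := (mul_eq_zero.mp h4).resolve_left hne
    have : (ζ + ζ⁻¹ - (√2 : ℝ)) * (ζ + ζ⁻¹ + (√2 : ℝ)) = 0 := by
      refine (mul_eq_zero.mp (?_ : ζ ^ 2 * _ = 0)).resolve_left (hpow 2)
      field_simp
      linear_combination h4' - ζ ^ 2 * hs
    rcases mul_eq_zero.mp this with h | h
    · right; right; right; left; linear_combination h
    · right; right; right; right; left; linear_combination h
  · have hx : ((ζ + ζ⁻¹) ^ 2 - (ζ + ζ⁻¹) - 1) * ((ζ + ζ⁻¹) ^ 2 + (ζ + ζ⁻¹) - 1) = 0 := by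
      refine (mul_eq_zero.mp (?_ : ζ ^ 4 * _ = 0)).resolve_left (hpow 4)
      simp only [Finset.sum_range_succ, Finset.sum_range_zero] at hg
      field_simp
      linear_combination hg
    generalize ζ + ζ⁻¹ = x at *
    generalize ((Real.goldenRatio : ℝ) : ℂ) = g at *
    -- The two quadratic factors correspond to `ζ` of order 10 and of order 5; each splits over
    -- `ℤ[φ]`.
    have hx' : (x - g) * (x - (1 - g)) * ((x + g) * (x - (g - 1))) = 0 := by
      linear_combination hx - (((x ^ 2 - x - 1) + (x ^ 2 + x - 1) - (g ^ 2 - g - 1))) * hφ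
    rcases mul_eq_zero.mp hx' with h | h <;> rcases mul_eq_zero.mp h with h | h
    · have : x = g := by linear_combination h
      tauto
    · have : x = 1 - g := by linear_combination h
      tauto
    · have : x = -g := by linear_combination h
      tauto
    · have : x = g - 1 := by linear_combination h
      tauto

/-! ### The braid action and the coordinates of good triples. -/

theorem braid_inv_smul_one (y : Fin 3 → ℂ) :
    (PresentedGroup.of 0 : BraidGroup3)⁻¹ • y = ![-y 0, y 2, y 1 - y 0 * y 2] := by
  rw [inv_smul_eq_iff, braid_smul_one]
  funext i
  fin_cases i <;> simp

theorem braid_inv_smul_two (y : Fin 3 → ℂ) :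
    (PresentedGroup.of 1 : BraidGroup3)⁻¹ • y = ![y 2 - y 1 * y 0, -y 1, y 0] := by
  rw [inv_smul_eq_iff, braid_smul_two]
  funext i
  fin_cases i <;> simp

theorem braid_smul_mem {S : Set (Fin 3 → ℂ)}
    (h1 : ∀ x ∈ S, (PresentedGroup.of 0 : BraidGroup3) • x ∈ S)
    (h2 : ∀ x ∈ S, (PresentedGroup.of 1 : BraidGroup3) • x ∈ S)
    (h1' : ∀ x ∈ S, (PresentedGroup.of 0 : BraidGroup3)⁻¹ • x ∈ S)
    (h2' : ∀ x ∈ S, (PresentedGroup.of 1 : BraidGroup3)⁻¹ • x ∈ S)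
    (β : BraidGroup3) {x : Fin 3 → ℂ} (hx : x ∈ S) : β • x ∈ S := by
  have hβ : β ∈ Subgroup.closure (Set.range (PresentedGroup.of (rels := braidRels))) := by
    rw [PresentedGroup.closure_range_of]
    trivial
  induction hβ using Subgroup.closure_induction'' generalizing x with
  | mem b hb =>
    obtain ⟨i, rfl⟩ := hb
    fin_cases i
    exacts [h1 x hx, h2 x hx]
  | inv_mem b hb =>
    obtain ⟨i, rfl⟩ := hb
    fin_cases i
    exacts [h1' x hx, h2' x hx]
  | one => rwa [one_smul]
  | mul a b _ _ ha hb =>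
    rw [mul_smul]
    exact ha (hb hx)

/-- The braid-invariant cubic form `x₁² + x₂² + x₃² - x₁ x₂ x₃`. -/
def cubicForm (x : Fin 3 → ℂ) : ℂ := x 0 ^ 2 + x 1 ^ 2 + x 2 ^ 2 - x 0 * x 1 * x 2

theorem cubicForm_smul (β : BraidGroup3) (x : Fin 3 → ℂ) : cubicForm (β • x) = cubicForm x := by
  have : β • x ∈ {y | cubicForm y = cubicForm x} := by
    refine braid_smul_mem (S := {y | cubicForm y = cubicForm x}) ?_ ?_ ?_ ?_ β rfl <;> intro y hy <;>
      rw [Set.mem_ofPred_eq] at * <;> rw [← hy]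
    · rw [braid_smul_one]; simp [cubicForm]; ring
    · rw [braid_smul_two]; simp [cubicForm]; ring
    · rw [braid_inv_smul_one]; simp [cubicForm]; ring
    · rw [braid_inv_smul_two]; simp [cubicForm]; ring
  exact this

theorem IsAdmissible.smul {x : Fin 3 → ℂ} (hx : IsAdmissible x) (β : BraidGroup3) :
    IsAdmissible (β • x) := by
  refine braid_smul_mem (S := {y | IsAdmissible y}) ?_ ?_ ?_ ?_ β hx <;> intro y hy <;>
    have h01 := hy 0 1 <;> have h02 := hy 0 2 <;> have h12 := hy 1 2
  · rw [braid_smul_one]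
    intro i j
    fin_cases i <;> fin_cases j <;> simp at * <;> intro h h' <;> simp_all
  · rw [braid_smul_two]
    intro i j
    fin_cases i <;> fin_cases j <;> simp at * <;> intro h h' <;> simp_all
  · rw [braid_inv_smul_one]
    intro i j
    fin_cases i <;> fin_cases j <;> simp at * <;> intro h h' <;> simp_all
  · rw [braid_inv_smul_two]
    intro i j
    fin_cases i <;> fin_cases j <;> simp at * <;> intro h h' <;> simp_all

theorem isTwoCos_neg_two_cos (r : ℚ) : IsTwoCos ((-2 * Real.cos (Real.pi * (r : ℝ)) : ℝ) : ℂ) := by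
  refine ⟨2 * r.den, by have := r.den_pos; omega,
    -Complex.exp ((Real.pi * (r : ℝ) : ℝ) * Complex.I), ?_, ?_⟩
  · rw [Even.neg_pow (even_two_mul _), ← Complex.exp_nat_mul, Complex.exp_eq_one_iff]
    refine ⟨r.num, ?_⟩
    have h : (r : ℂ) * r.den = r.num := by exact_mod_cast Rat.mul_den_eq_num r
    push_cast
    linear_combination (2 * Real.pi * Complex.I : ℂ) * h
  · push_cast
    rw [Complex.cos, inv_neg, ← Complex.exp_neg, neg_mul]
    ring_nf

theorem IsGood.isTwoCos {x : Fin 3 → ℂ} (hx : IsGood x) (β : BraidGroup3) (i : Fin 3) :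
    IsTwoCos ((β • x) i) := by
  obtain ⟨r, hr⟩ := hx.2 β
  rw [(hr i).2.2]
  exact isTwoCos_neg_two_cos _

theorem IsTwoCos.of_sq_eq_one_mul {a z : ℂ} (ha : a ^ 2 = 1) (h : IsTwoCos (a * z)) :
    IsTwoCos z := by
  obtain ⟨m, hm, ξ, hξ, h⟩ := h
  have hai : a⁻¹ = a := inv_eq_of_mul_eq_one_right (by rw [← sq, ha])
  refine ⟨2 * m, by omega, a * ξ, ?_, ?_⟩
  · rw [mul_pow, pow_mul, ha, one_pow, one_mul, mul_comm 2 m, pow_mul, hξ, one_pow]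
  · rw [mul_inv, hai]
    linear_combination a * h - z * ha

theorem zeroth_mem_smallCosines {x : Fin 3 → ℂ} (hadm : IsAdmissible x)
    (h : ∀ (β : BraidGroup3) (i : Fin 3), IsTwoCos ((β • x) i)) (h4 : cubicForm x ≠ 4) :
    x 0 ∈ smallCosines := by
  have h0 := h 1 0
  rw [one_smul] at h0
  obtain ⟨m, hm, ζ, hζ, hxζ⟩ := h0
  let step : ℂ × ℂ → ℂ × ℂ := fun p => (p.2, x 0 * p.2 - p.1)
  let v : ℕ → ℂ := fun k => (step^[k] (x 1, x 2)).1
  have hv' : ∀ k, (step^[k] (x 1, x 2)).2 = v (k + 1) := fun k => by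
    simp only [v, Function.iterate_succ_apply']
    rfl
  have hrec : ∀ k, v (k + 2) = x 0 * v (k + 1) - v k := fun k => by
    rw [← hv' (k + 1), Function.iterate_succ_apply']
    simp only [step, hv']
    rfl
  -- `a * b * c = 1` gives `a * c = b`, so the new entry `b * v k - a * c * x 0 * v (k + 1)` is
  -- exactly `-b * v (k + 2)`.
  have key : ∀ k, ∃ a b c : ℂ, a ^ 2 = 1 ∧ b ^ 2 = 1 ∧ c ^ 2 = 1 ∧ a * b * c = 1 ∧
      ∃ β : BraidGroup3, β • x = ![a * x 0, b * v k, c * v (k + 1)] := by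
    intro k
    induction k with
    | zero =>
      refine ⟨1, 1, 1, by simp, by simp, by simp, by simp, 1, ?_⟩
      rw [one_smul]
      funext i
      fin_cases i
      · simp
      · simp [v]
      · simp [v, step]
    | succ k ih =>
      obtain ⟨a, b, c, ha, hb, hc, habc, β, hβ⟩ := ih
      refine ⟨-a, c, -b, by rwa [neg_sq], hc, by rwa [neg_sq], by linear_combination habc,
        (PresentedGroup.of 0)⁻¹ * β, ?_⟩
      rw [mul_smul, braid_inv_smul_one, hβ, hrec]
      funext i
      fin_cases i
      · simp
      · simp
      · simp
        linear_combination (-(b * x 0 * v (k + 1))) * habc + (x 0 * v (k + 1) * a * c) * hb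
  have hvcos : ∀ k, IsTwoCos (v k) := by
    intro k
    obtain ⟨a, b, c, ha, hb, hc, -, β, hβ⟩ := key k
    refine IsTwoCos.of_sq_eq_one_mul hb ?_
    have := h β 1
    rwa [hβ] at this
  have hv0 : v 0 = x 1 := rfl
  have hv1 : v 1 = x 2 := rfl
  obtain ⟨n, hn2, hn5, hn⟩ := order_le_five hm hζ (v := v) (by rw [← hxζ]; exact hrec) hvcos
    (by
      rw [← hxζ, hv0, hv1]
      intro h
      apply h4
      unfold cubicForm
      linear_combination h)
    (by
      rintro ⟨h1, h2⟩
      exact absurd (hadm 1 2 h1 h2) (by decide))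
  rw [hxζ]
  exact mem_smallCosines hn2 hn5 hn

theorem IsGood.mem_smallCosines {x : Fin 3 → ℂ} (hx : IsGood x) (h4 : cubicForm x ≠ 4)
    (β : BraidGroup3) (i : Fin 3) : (β • x) i ∈ smallCosines := by
  have hzero : ∀ γ : BraidGroup3, (γ • x) 0 ∈ smallCosines := fun γ =>
    zeroth_mem_smallCosines (hx.1.smul γ) (fun δ j => by rw [← mul_smul]; exact hx.isTwoCos _ j)
      (by rwa [cubicForm_smul])
  fin_cases i
  · exact hzero β
  -- `β₂ β₁` carries the middle coordinate to the first place, and `β₂` carries the last one there.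
  · have := hzero (PresentedGroup.of 1 * PresentedGroup.of 0 * β)
    rw [mul_smul, mul_smul, braid_smul_two, braid_smul_one] at this
    exact this
  · have := hzero (PresentedGroup.of 1 * β)
    rw [mul_smul, braid_smul_two] at this
    exact this

/-! ### Exact arithmetic in `ℤ[√2, φ]`. -/

/-- The element `a + b √2 + c φ + d √2 φ` of `ℤ[√2, φ]`, with `φ` the golden ratio. -/
structure BiquadInt where
  a : ℤ
  b : ℤ
  c : ℤ
  d : ℤ
deriving DecidableEq

namespace BiquadInt

/-- The complex number represented by the coefficients. -/
noncomputable def val (x : BiquadInt) : ℂ :=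
  x.a + x.b * (√2 : ℝ) + x.c * (Real.goldenRatio : ℝ) + x.d * ((√2 : ℝ) * (Real.goldenRatio : ℝ))

def neg (x : BiquadInt) : BiquadInt := ⟨-x.a, -x.b, -x.c, -x.d⟩

def add (x y : BiquadInt) : BiquadInt := ⟨x.a + y.a, x.b + y.b, x.c + y.c, x.d + y.d⟩

def sub (x y : BiquadInt) : BiquadInt := ⟨x.a - y.a, x.b - y.b, x.c - y.c, x.d - y.d⟩

def mul (x y : BiquadInt) : BiquadInt :=
  ⟨x.a * y.a + 2 * (x.b * y.b) + x.c * y.c + 2 * (x.d * y.d),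
   x.a * y.b + x.b * y.a + x.c * y.d + x.d * y.c,
   x.a * y.c + x.c * y.a + x.c * y.c + 2 * (x.b * y.d + x.d * y.b + x.d * y.d),
   x.a * y.d + x.d * y.a + x.b * y.c + x.c * y.b + x.c * y.d + x.d * y.c⟩

theorem val_neg (x : BiquadInt) : (neg x).val = -x.val := by
  simp only [val, neg]
  push_cast
  ring

theorem val_add (x y : BiquadInt) : (add x y).val = x.val + y.val := by
  simp only [val, add]
  push_cast
  ring

theorem val_sub (x y : BiquadInt) : (sub x y).val = x.val - y.val := by
  simp only [val, sub]
  push_cast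
  ring

theorem val_mul (x y : BiquadInt) : (mul x y).val = x.val * y.val := by
  have h1 := goldenRatio_sq_complex
  have h2 := sqrt_two_sq_complex
  simp only [val, mul]
  generalize ((√2 : ℝ) : ℂ) = s at *
  generalize ((Real.goldenRatio : ℝ) : ℂ) = g at *
  push_cast
  linear_combination (-(x.b : ℂ) * y.b - (x.b * y.d + x.d * y.b) * g - x.d * y.d * g ^ 2) * h2 -
    (x.c * y.c + (x.c * y.d + x.d * y.c) * s + 2 * x.d * y.d) * h1

/-- A numerical test that two elements are distinct. -/
def apart (x y : BiquadInt) : Bool :=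
  decide (|x.b - y.b| + |x.c - y.c| + |x.d - y.d| <
    |(x.a - y.a) * 1000000 + (x.b - y.b) * 1414214 + (x.c - y.c) * 1618034 +
      (x.d - y.d) * 2288246|)

/-- The integers in `apart` are `√2`, `φ` and `√2 φ` times a million, each with error at most 1. If
the values agreed, the approximate difference would be at most the sum of the absolute values of the
coefficient differences in `b`, `c`, `d`. -/
theorem val_ne_of_apart {x y : BiquadInt} (h : apart x y = true) : x.val ≠ y.val := by
  rw [apart, decide_eq_true_eq] at h
  intro he
  have he' : (x.sub y).val = 0 := by rw [val_sub, he, sub_self]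
  simp only [val, sub] at he'
  generalize x.a - y.a = a at *
  generalize x.b - y.b = b at *
  generalize x.c - y.c = c at *
  generalize x.d - y.d = d at *
  have hr : (a : ℝ) + b * √2 + c * Real.goldenRatio + d * (√2 * Real.goldenRatio) = 0 := by
    exact_mod_cast he'
  have hs1 : 1.41421356 < √2 := Real.lt_sqrt_of_sq_lt (by norm_num)
  have hs2 : √2 < 1.41421357 := (Real.sqrt_lt' (by norm_num)).mpr (by norm_num)
  have ht1 : 2.23606797 < √5 := Real.lt_sqrt_of_sq_lt (by norm_num)
  have ht2 : √5 < 2.23606799 := (Real.sqrt_lt' (by norm_num)).mpr (by norm_num)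
  have hg1 : 1.61803398 < Real.goldenRatio := by unfold Real.goldenRatio; linarith
  have hg2 : Real.goldenRatio < 1.618033995 := by unfold Real.goldenRatio; linarith
  generalize √2 = s at *
  generalize Real.goldenRatio = g at *
  have e1 : |1414214 - 1000000 * s| ≤ 1 := by rw [abs_le]; constructor <;> linarith
  have e2 : |1618034 - 1000000 * g| ≤ 1 := by rw [abs_le]; constructor <;> linarith
  have e3 : |2288246 - 1000000 * (s * g)| ≤ 1 := by rw [abs_le]; constructor <;> nlinarith
  have hR : (|(b : ℝ)| + |(c : ℝ)| + |(d : ℝ)| : ℝ) <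
    |(a : ℝ) * 1000000 + b * 1414214 + c * 1618034 + d * 2288246| := by exact_mod_cast h
  have e : (a : ℝ) * 1000000 + b * 1414214 + c * 1618034 + d * 2288246 =
      b * (1414214 - 1000000 * s) + c * (1618034 - 1000000 * g) +
        d * (2288246 - 1000000 * (s * g)) := by
    linear_combination 1000000 * hr
  rw [e] at hR
  have t1 := abs_add_three (b * (1414214 - 1000000 * s)) (c * (1618034 - 1000000 * g))
    (d * (2288246 - 1000000 * (s * g)))
  simp only [abs_mul] at t1
  nlinarith [mul_le_mul_of_nonneg_left e1 (abs_nonneg (b : ℝ)),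
    mul_le_mul_of_nonneg_left e2 (abs_nonneg (c : ℝ)),
    mul_le_mul_of_nonneg_left e3 (abs_nonneg (d : ℝ))]

/-- Representatives of `0, 1, -1, √2, -√2, φ, -φ, φ⁻¹, -φ⁻¹`. -/
def alphabet : List BiquadInt :=
  [⟨0, 0, 0, 0⟩, ⟨1, 0, 0, 0⟩, ⟨-1, 0, 0, 0⟩, ⟨0, 1, 0, 0⟩, ⟨0, -1, 0, 0⟩, ⟨0, 0, 1, 0⟩,
    ⟨0, 0, -1, 0⟩, ⟨-1, 0, 1, 0⟩, ⟨1, 0, -1, 0⟩]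

theorem mem_smallCosines_iff {z : ℂ} : z ∈ smallCosines ↔ ∃ x ∈ alphabet, z = x.val := by
  simp [smallCosines, alphabet, val, sub_eq_add_neg, add_comm]

/-- The test that an element differs from all those of `alphabet`. -/
def outside (x : BiquadInt) : Bool := alphabet.all (apart x)

theorem val_notMem_of_outside {x : BiquadInt} (h : outside x = true) : x.val ∉ smallCosines := by
  rw [mem_smallCosines_iff]
  rintro ⟨y, hy, he⟩
  exact val_ne_of_apart (List.all_eq_true.mp h y hy) he

end BiquadInt

/-! ### Computation of the orbits and the finite classification. -/

/-- Triples of elements of `ℤ[√2, φ]`. -/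
structure BiquadTriple where
  x : BiquadInt
  y : BiquadInt
  z : BiquadInt
deriving DecidableEq

namespace BiquadTriple

open BiquadInt

/-- The complex triple represented by the coefficients. -/
noncomputable def val (t : BiquadTriple) : Fin 3 → ℂ := ![t.x.val, t.y.val, t.z.val]

def step₁ (t : BiquadTriple) : BiquadTriple := ⟨t.x.neg, t.z.sub (t.x.mul t.y), t.y⟩

def step₂ (t : BiquadTriple) : BiquadTriple := ⟨t.z, t.y.neg, t.x.sub (t.y.mul t.z)⟩

def step₁Inv (t : BiquadTriple) : BiquadTriple := ⟨t.x.neg, t.z, t.y.sub (t.x.mul t.z)⟩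

def step₂Inv (t : BiquadTriple) : BiquadTriple := ⟨t.z.sub (t.y.mul t.x), t.y.neg, t.x⟩

theorem val_step₁ (t : BiquadTriple) :
    t.step₁.val = (PresentedGroup.of 0 : BraidGroup3) • t.val := by
  simp [braid_smul_one, val, step₁, val_neg, val_sub, val_mul]

theorem val_step₂ (t : BiquadTriple) :
    t.step₂.val = (PresentedGroup.of 1 : BraidGroup3) • t.val := by
  simp [braid_smul_two, val, step₂, val_neg, val_sub, val_mul]

theorem val_step₁Inv (t : BiquadTriple) :
    t.step₁Inv.val = (PresentedGroup.of 0 : BraidGroup3)⁻¹ • t.val := by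
  simp [braid_inv_smul_one, val, step₁Inv, val_neg, val_sub, val_mul]

theorem val_step₂Inv (t : BiquadTriple) :
    t.step₂Inv.val = (PresentedGroup.of 1 : BraidGroup3)⁻¹ • t.val := by
  simp [braid_inv_smul_two, val, step₂Inv, val_neg, val_sub, val_mul]

/-- The test that at most `n` applications of the generators lead to a triple with an entry outside
`alphabet`. -/
def escapes : ℕ → BiquadTriple → Bool
  | 0, _ => false
  | n + 1, t => outside (t.z.sub (t.x.mul t.y)) || outside (t.x.sub (t.y.mul t.z)) ||
      escapes n t.step₁ || escapes n t.step₂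

theorem exists_notMem_of_escapes {n : ℕ} {t : BiquadTriple} (h : escapes n t = true) :
    ∃ (β : BraidGroup3) (i : Fin 3), (β • t.val) i ∉ smallCosines := by
  induction n generalizing t with
  | zero => simp [escapes] at h
  | succ n ih =>
    simp only [escapes, Bool.or_eq_true] at h
    rcases h with ((h | h) | h) | h
    · refine ⟨PresentedGroup.of 0, 1, ?_⟩
      rw [← val_step₁]
      exact val_notMem_of_outside h
    · refine ⟨PresentedGroup.of 1, 2, ?_⟩
      rw [← val_step₂]
      exact val_notMem_of_outside h
    · obtain ⟨β, i, hi⟩ := ih h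
      rw [val_step₁, ← mul_smul] at hi
      exact ⟨_, i, hi⟩
    · obtain ⟨β, i, hi⟩ := ih h
      rw [val_step₂, ← mul_smul] at hi
      exact ⟨_, i, hi⟩

/-- Breadth-first search from `frontier`, for `n` rounds. -/
def explore : ℕ → List BiquadTriple → List BiquadTriple → List BiquadTriple
  | 0, seen, _ => seen
  | n + 1, seen, frontier =>
    let fresh := ((frontier.map step₁ ++ frontier.map step₂).filter (· ∉ seen)).dedup
    explore n (seen ++ fresh) fresh

theorem explore_val_mem {S : Set (Fin 3 → ℂ)}
    (h1 : ∀ x ∈ S, (PresentedGroup.of 0 : BraidGroup3) • x ∈ S)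
    (h2 : ∀ x ∈ S, (PresentedGroup.of 1 : BraidGroup3) • x ∈ S) {n : ℕ}
    {seen frontier : List BiquadTriple} (hs : ∀ t ∈ seen, t.val ∈ S)
    (hf : ∀ t ∈ frontier, t.val ∈ S) : ∀ t ∈ explore n seen frontier, t.val ∈ S := by
  induction n generalizing seen frontier with
  | zero => exact hs
  | succ n ih =>
    rw [explore]
    have hfresh : ∀ t ∈ ((frontier.map step₁ ++ frontier.map step₂).filter (· ∉ seen)).dedup,
        t.val ∈ S := by
      intro t ht
      rw [List.mem_dedup, List.mem_filter, List.mem_append, List.mem_map, List.mem_map] at ht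
      rcases ht.1 with ⟨u, hu, rfl⟩ | ⟨u, hu, rfl⟩
      · rw [val_step₁]
        exact h1 _ (hf u hu)
      · rw [val_step₂]
        exact h2 _ (hf u hu)
    refine ih (fun t ht => ?_) hfresh
    rcases List.mem_append.mp ht with ht | ht
    · exact hs t ht
    · exact hfresh t ht

/-- The five representatives, in coordinates. -/
def base : Fin 5 → BiquadTriple :=
  ![⟨⟨0, 0, 0, 0⟩, ⟨-1, 0, 0, 0⟩, ⟨-1, 0, 0, 0⟩⟩,
    ⟨⟨0, 0, 0, 0⟩, ⟨-1, 0, 0, 0⟩, ⟨0, -1, 0, 0⟩⟩,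
    ⟨⟨0, 0, 0, 0⟩, ⟨-1, 0, 0, 0⟩, ⟨0, 0, -1, 0⟩⟩,
    ⟨⟨0, 0, 0, 0⟩, ⟨-1, 0, 0, 0⟩, ⟨1, 0, -1, 0⟩⟩,
    ⟨⟨0, 0, 0, 0⟩, ⟨0, 0, -1, 0⟩, ⟨1, 0, -1, 0⟩⟩]

/-- The orbit of a representative, as a list. -/
def orbitList (k : Fin 5) : List BiquadTriple := explore 10 [base k] [base k]

theorem val_mem_orbit {k : Fin 5} {t : BiquadTriple} (ht : t ∈ orbitList k) :
    t.val ∈ MulAction.orbit BraidGroup3 (base k).val := by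
  refine explore_val_mem (S := MulAction.orbit BraidGroup3 (base k).val) ?_ ?_ ?_ ?_ t ht
  · exact fun x hx => MulAction.mem_orbit_of_mem_orbit _ hx
  · exact fun x hx => MulAction.mem_orbit_of_mem_orbit _ hx
  · simp [MulAction.mem_orbit_self]
  · simp [MulAction.mem_orbit_self]

-- This certifies that ten rounds of search exhaust each orbit.
set_option maxRecDepth 100000 in
theorem orbitList_closed : ∀ k, ∀ t ∈ orbitList k, t.step₁ ∈ orbitList k ∧
    t.step₂ ∈ orbitList k ∧ t.step₁Inv ∈ orbitList k ∧ t.step₂Inv ∈ orbitList k := by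
  decide +kernel

theorem orbit_base_eq (k : Fin 5) :
    MulAction.orbit BraidGroup3 (base k).val = val '' {t | t ∈ orbitList k} := by
  refine Set.Subset.antisymm ?_ ?_
  · rintro _ ⟨β, rfl⟩
    have hmem : base k ∈ orbitList k := by
      revert k
      decide +kernel
    refine braid_smul_mem (S := val '' {t | t ∈ orbitList k}) ?_ ?_ ?_ ?_ β
      ⟨base k, hmem, rfl⟩ <;> rintro _ ⟨t, ht, rfl⟩
    · exact ⟨_, (orbitList_closed k t ht).1, val_step₁ t⟩
    · exact ⟨_, (orbitList_closed k t ht).2.1, val_step₂ t⟩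
    · exact ⟨_, (orbitList_closed k t ht).2.2.1, val_step₁Inv t⟩
    · exact ⟨_, (orbitList_closed k t ht).2.2.2, val_step₂Inv t⟩
  · rintro _ ⟨t, ht, rfl⟩
    exact val_mem_orbit ht

/-- The invariant cubic form in coordinates. -/
def form (t : BiquadTriple) : BiquadInt :=
  (((t.x.mul t.x).add (t.y.mul t.y)).add (t.z.mul t.z)).sub ((t.x.mul t.y).mul t.z)

theorem val_form (t : BiquadTriple) : t.form.val = cubicForm t.val := by
  simp [form, cubicForm, val, val_add, val_sub, val_mul]
  ring

/-- The test that two of the entries are literally zero. -/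
def degenerate (t : BiquadTriple) : Bool :=
  (t.x == ⟨0, 0, 0, 0⟩ && t.y == ⟨0, 0, 0, 0⟩) || (t.x == ⟨0, 0, 0, 0⟩ && t.z == ⟨0, 0, 0, 0⟩) ||
    (t.y == ⟨0, 0, 0, 0⟩ && t.z == ⟨0, 0, 0, 0⟩)

theorem not_isAdmissible_of_degenerate {t : BiquadTriple} (h : degenerate t = true) :
    ¬ IsAdmissible t.val := by
  obtain ⟨x, y, z⟩ := t
  have h0 : BiquadInt.val ⟨0, 0, 0, 0⟩ = 0 := by simp [BiquadInt.val]
  simp only [degenerate, Bool.or_eq_true, Bool.and_eq_true, beq_iff_eq] at h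
  intro hadm
  rcases h with (⟨rfl, rfl⟩ | ⟨rfl, rfl⟩) | ⟨rfl, rfl⟩
  · exact absurd (hadm 0 1 h0 h0) (by decide)
  · exact absurd (hadm 0 2 h0 h0) (by decide)
  · exact absurd (hadm 1 2 h0 h0) (by decide)

/-- The first three alternatives contradict, in turn, admissibility, the hypothesis on the cubic
form and goodness. Words of length at most two suffice for the third. -/
theorem alphabet_cases : ∀ x ∈ alphabet, ∀ y ∈ alphabet, ∀ z ∈ alphabet,
    degenerate ⟨x, y, z⟩ = true ∨ form ⟨x, y, z⟩ = ⟨4, 0, 0, 0⟩ ∨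
      escapes 2 ⟨x, y, z⟩ = true ∨ ∃ k, ⟨x, y, z⟩ ∈ orbitList k := by
  decide +kernel

theorem mem_orbit_of_isGood {x : Fin 3 → ℂ} (hx : IsGood x) (h4 : cubicForm x ≠ 4) :
    ∃ k, x ∈ MulAction.orbit BraidGroup3 (base k).val := by
  have hmem := hx.mem_smallCosines h4
  have h1 := hmem 1
  simp only [one_smul, mem_smallCosines_iff] at h1
  obtain ⟨a, ha, hxa⟩ := h1 0
  obtain ⟨b, hb, hxb⟩ := h1 1
  obtain ⟨c, hc, hxc⟩ := h1 2
  have hxt : x = (⟨a, b, c⟩ : BiquadTriple).val := by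
    funext i
    fin_cases i
    exacts [hxa, hxb, hxc]
  rcases alphabet_cases a ha b hb c hc with h | h | h | ⟨k, h⟩
  · exact absurd (hxt ▸ hx.1) (not_isAdmissible_of_degenerate h)
  · refine absurd ?_ h4
    rw [hxt, ← val_form, h]
    simp [BiquadInt.val]
  · obtain ⟨β, i, hi⟩ := exists_notMem_of_escapes h
    exact absurd (hxt ▸ hmem β i) hi
  · exact ⟨k, hxt ▸ val_mem_orbit h⟩

/-! ### From cosines to coordinates; permutations. -/

theorem cos_two_pi_div_five : Real.cos (2 * Real.pi / 5) = (Real.goldenRatio - 1) / 2 := by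
  rw [mul_div_assoc, Real.cos_two_mul, Real.cos_pi_div_five, Real.goldenRatio]
  have := Real.sq_sqrt (show (0 : ℝ) ≤ 5 by norm_num)
  linear_combination (1 / 8 : ℝ) * this

theorem cos_pi_div_five_eq_goldenRatio : Real.cos (Real.pi / 5) = Real.goldenRatio / 2 := by
  rw [Real.cos_pi_div_five, Real.goldenRatio]
  ring

theorem val_base (k : Fin 5) : (base k).val = baseTriple k := by
  have h5 := cos_two_pi_div_five
  have h5' := cos_pi_div_five_eq_goldenRatio
  funext i
  fin_cases k <;> fin_cases i <;>
    simp [val, BiquadInt.val, base, baseTriple, cosTriple, h5, h5', -Real.cos_pi_div_five] <;> ring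

/-- The further triples of the theorem, in coordinates. -/
def further : Fin 5 → List BiquadTriple :=
  ![[⟨⟨1, 0, 0, 0⟩, ⟨1, 0, 0, 0⟩, ⟨1, 0, 0, 0⟩⟩],
    [⟨⟨1, 0, 0, 0⟩, ⟨0, -1, 0, 0⟩, ⟨0, -1, 0, 0⟩⟩],
    [⟨⟨1, 0, 0, 0⟩, ⟨0, 0, -1, 0⟩, ⟨0, 0, -1, 0⟩⟩,
      ⟨⟨0, 0, 1, 0⟩, ⟨0, 0, 1, 0⟩, ⟨0, 0, 1, 0⟩⟩],
    [⟨⟨1, 0, 0, 0⟩, ⟨1, 0, -1, 0⟩, ⟨1, 0, -1, 0⟩⟩,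
      ⟨⟨1, 0, -1, 0⟩, ⟨1, 0, -1, 0⟩, ⟨1, 0, -1, 0⟩⟩],
    [⟨⟨-1, 0, 1, 0⟩, ⟨-1, 0, 0, 0⟩, ⟨0, 0, -1, 0⟩⟩,
      ⟨⟨1, 0, -1, 0⟩, ⟨-1, 0, 0, 0⟩, ⟨-1, 0, 0, 0⟩⟩,
      ⟨⟨1, 0, 0, 0⟩, ⟨-1, 0, 0, 0⟩, ⟨0, 0, -1, 0⟩⟩]]

theorem exists_further {k : Fin 5} {t : Fin 3 → ℂ} (ht : t ∈ furtherTriples k) :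
    ∃ u ∈ further k, t = u.val := by
  have h5 := cos_two_pi_div_five
  have h5' := cos_pi_div_five_eq_goldenRatio
  have h35 : Real.cos (3 * Real.pi / 5) = (1 - Real.goldenRatio) / 2 := by
    rw [show 3 * Real.pi / 5 = Real.pi - 2 * Real.pi / 5 by ring, Real.cos_pi_sub, h5]
    ring
  have h45 : Real.cos (4 * Real.pi / 5) = -Real.goldenRatio / 2 := by
    rw [show 4 * Real.pi / 5 = Real.pi - Real.pi / 5 by ring, Real.cos_pi_sub, h5']
    ring
  have h23 : Real.cos (2 * Real.pi / 3) = -1 / 2 := by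
    rw [show 2 * Real.pi / 3 = Real.pi - Real.pi / 3 by ring, Real.cos_pi_sub,
      Real.cos_pi_div_three]
    ring
  fin_cases k <;> simp [furtherTriples] at ht
  · subst ht
    refine ⟨_, List.mem_cons_self .., ?_⟩
    funext i
    fin_cases i <;> simp [val, BiquadInt.val]
  · subst ht
    refine ⟨_, List.mem_cons_self .., ?_⟩
    funext i
    fin_cases i <;> simp [val, BiquadInt.val, cosTriple, h23] <;> ring
  · rcases ht with rfl | rfl
    · refine ⟨_, List.mem_cons_self .., ?_⟩
      funext i
      fin_cases i <;> simp [val, BiquadInt.val, cosTriple, h23, h5', -Real.cos_pi_div_five] <;> ring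
    · refine ⟨_, List.mem_cons_of_mem _ (List.mem_cons_self ..), ?_⟩
      funext i
      fin_cases i <;> simp [val, BiquadInt.val, cosTriple, h45] <;> ring
  · rcases ht with rfl | rfl
    · refine ⟨_, List.mem_cons_self .., ?_⟩
      funext i
      fin_cases i <;> simp [val, BiquadInt.val, cosTriple, h23, h5] <;> ring
    · refine ⟨_, List.mem_cons_of_mem _ (List.mem_cons_self ..), ?_⟩
      funext i
      fin_cases i <;> simp [val, BiquadInt.val, cosTriple, h5] <;> ring
  · rcases ht with rfl | rfl | rfl
    · refine ⟨_, List.mem_cons_self .., ?_⟩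
      funext i
      fin_cases i <;> simp [val, BiquadInt.val, cosTriple, h35, h5', -Real.cos_pi_div_five] <;> ring
    · refine ⟨_, List.mem_cons_of_mem _ (List.mem_cons_self ..), ?_⟩
      funext i
      fin_cases i <;> simp [val, BiquadInt.val, cosTriple, h5]
      ring
    · refine ⟨_, List.mem_cons_of_mem _ (List.mem_cons_of_mem _ (List.mem_cons_self ..)), ?_⟩
      funext i
      fin_cases i <;> simp [val, BiquadInt.val, cosTriple, h23, h5', -Real.cos_pi_div_five] <;> ring

/-- The entries as a function on indices. -/
def entry (t : BiquadTriple) : Fin 3 → BiquadInt := ![t.x, t.y, t.z]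

/-- The triple with permuted entries. -/
def permute (t : BiquadTriple) (σ : Equiv.Perm (Fin 3)) : BiquadTriple :=
  ⟨t.entry (σ 0), t.entry (σ 1), t.entry (σ 2)⟩

theorem val_apply (t : BiquadTriple) (i : Fin 3) : t.val i = (t.entry i).val := by
  fin_cases i <;> rfl

theorem val_permute (t : BiquadTriple) (σ : Equiv.Perm (Fin 3)) :
    (t.permute σ).val = t.val ∘ σ := by
  funext i
  rw [Function.comp_apply, val_apply, val_apply]
  fin_cases i <;> rfl

theorem permute_mem_orbitList : ∀ k, ∀ t ∈ base k :: further k, ∀ σ, t.permute σ ∈ orbitList k := by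
  decide +kernel

theorem comp_perm_mem_orbit {k : Fin 5} {t : BiquadTriple} (ht : t ∈ base k :: further k)
    (σ : Equiv.Perm (Fin 3)) : t.val ∘ σ ∈ MulAction.orbit BraidGroup3 (base k).val := by
  rw [← val_permute]
  exact val_mem_orbit (permute_mem_orbitList k t ht σ)

/-! ### Separation of the five orbits. -/

/-- The cubic form takes the values `2`, `3`, `2 + φ`, `3 - φ`, `3`; only indices 1 and 4 collide.
-/
theorem form_base_apart : ∀ k l, k ≠ l → ¬ (k = 1 ∧ l = 4) → ¬ (k = 4 ∧ l = 1) →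
    apart (base k).form (base l).form = true := by
  decide +kernel

/-- Squares of coordinates ignore sign changes, so they can separate the two orbits on which the
cubic form is 3. -/
theorem sq_mem_of_mem_orbitList : ∀ t ∈ orbitList 1, ∀ i, (t.entry i).mul (t.entry i) ∈
    ([⟨0, 0, 0, 0⟩, ⟨1, 0, 0, 0⟩, ⟨2, 0, 0, 0⟩] : List BiquadInt) := by
  decide +kernel

theorem exists_sq_apart_of_mem_orbitList : ∀ t ∈ orbitList 4, ∃ i,
    ∀ s ∈ ([⟨0, 0, 0, 0⟩, ⟨1, 0, 0, 0⟩, ⟨2, 0, 0, 0⟩] : List BiquadInt),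
      apart s ((t.entry i).mul (t.entry i)) = true := by
  decide +kernel

end BiquadTriple

theorem EquivalentTriples.sq_eq {x y : Fin 3 → ℂ} (h : EquivalentTriples x y) (i : Fin 3) :
    x i ^ 2 = y i ^ 2 := by
  rcases h with rfl | rfl | rfl | rfl <;> fin_cases i <;> simp

theorem EquivalentTriples.cubicForm_eq {x y : Fin 3 → ℂ} (h : EquivalentTriples x y) :
    cubicForm x = cubicForm y := by
  rcases h with rfl | rfl | rfl | rfl <;> simp [cubicForm]

theorem not_equivalentTriples_of_ne {k l : Fin 5} (hkl : k ≠ l) {x y : Fin 3 → ℂ}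
    (hx : x ∈ MulAction.orbit BraidGroup3 (baseTriple k))
    (hy : y ∈ MulAction.orbit BraidGroup3 (baseTriple l)) : ¬ EquivalentTriples x y := by
  intro h
  rw [← BiquadTriple.val_base] at hx hy
  have octahedral_icosahedral : ∀ x ∈ MulAction.orbit BraidGroup3 (BiquadTriple.base 1).val,
      ∀ y ∈ MulAction.orbit BraidGroup3 (BiquadTriple.base 4).val,
      ¬ ∀ i, x i ^ 2 = y i ^ 2 := by
    intro x hx y hy h
    rw [BiquadTriple.orbit_base_eq] at hx hy
    obtain ⟨t, ht, rfl⟩ := hx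
    obtain ⟨u, hu, rfl⟩ := hy
    obtain ⟨i, hi⟩ := BiquadTriple.exists_sq_apart_of_mem_orbitList u hu
    have := BiquadInt.val_ne_of_apart (hi _ (BiquadTriple.sq_mem_of_mem_orbitList t ht i))
    rw [BiquadInt.val_mul, BiquadInt.val_mul, ← BiquadTriple.val_apply, ← BiquadTriple.val_apply,
      ← sq, ← sq] at this
    exact this (h i)
  by_cases h14 : k = 1 ∧ l = 4
  · obtain ⟨rfl, rfl⟩ := h14
    exact octahedral_icosahedral x hx y hy h.sq_eq
  by_cases h41 : k = 4 ∧ l = 1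
  · obtain ⟨rfl, rfl⟩ := h41
    exact octahedral_icosahedral y hy x hx fun i => (h.sq_eq i).symm
  have hne := BiquadInt.val_ne_of_apart (BiquadTriple.form_base_apart k l hkl h14 h41)
  rw [BiquadTriple.val_form, BiquadTriple.val_form] at hne
  obtain ⟨β, rfl⟩ := hx
  obtain ⟨γ, rfl⟩ := hy
  have := h.cubicForm_eq
  simp only [cubicForm_smul] at this
  exact hne this

theorem theorem1p6 :
    (∀ x : Fin 3 → ℂ, IsGood x →
      x 0 ^ 2 + x 1 ^ 2 + x 2 ^ 2 - x 0 * x 1 * x 2 ≠ 4 →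
      ∃ k : Fin 5, x ∈ MulAction.orbit BraidGroup3 (baseTriple k)) ∧
    (∀ k : Fin 5, (MulAction.orbit BraidGroup3 (baseTriple k)).Finite) ∧
    (∀ k l : Fin 5, k ≠ l →
      MulAction.orbit BraidGroup3 (baseTriple k) ≠ MulAction.orbit BraidGroup3 (baseTriple l) ∧
      ∀ x ∈ MulAction.orbit BraidGroup3 (baseTriple k),
        ∀ y ∈ MulAction.orbit BraidGroup3 (baseTriple l), ¬ EquivalentTriples x y) ∧
    (∀ (k : Fin 5) (σ : Equiv.Perm (Fin 3)),
      baseTriple k ∘ σ ∈ MulAction.orbit BraidGroup3 (baseTriple k)) ∧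
    (∀ k : Fin 5, ∀ t ∈ furtherTriples k, ∀ σ : Equiv.Perm (Fin 3),
      t ∘ σ ∈ MulAction.orbit BraidGroup3 (baseTriple k)) := by
  refine ⟨fun x hx h4 => ?_, fun k => ?_, fun k l hkl => ⟨fun h => ?_, fun x hx y hy => ?_⟩,
    fun k σ => ?_, fun k t ht σ => ?_⟩
  · simp_rw [← BiquadTriple.val_base]
    exact BiquadTriple.mem_orbit_of_isGood hx h4
  · rw [← BiquadTriple.val_base, BiquadTriple.orbit_base_eq]
    exact (List.finite_toSet _).image _
  · exact not_equivalentTriples_of_ne hkl (MulAction.mem_orbit_self _)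
      (h ▸ MulAction.mem_orbit_self (baseTriple k)) (Or.inl rfl)
  · exact not_equivalentTriples_of_ne hkl hx hy
  · rw [← BiquadTriple.val_base]
    exact BiquadTriple.comp_perm_mem_orbit List.mem_cons_self σ
  · obtain ⟨u, hu, rfl⟩ := BiquadTriple.exists_further ht
    rw [← BiquadTriple.val_base]
    exact BiquadTriple.comp_perm_mem_orbit (List.mem_cons_of_mem _ hu) σ
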